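/- Lemma. Let $\mathbb K$ be a field of characteristic $0$, and let $\mathcal D$ be a non-empty class of finite groups closed under subquotients (in particular under isomorphism) and direct products (for instance the class of all finite groups). Let $\mathbb K\mathcal D$ be the biset category over $\mathbb K$ with objects the groups in $\mathcal D$: $\mathrm{Hom}(G,H)=\mathbb K\otimes_{\mathbb Z}B(H,G)$, where $B(H,G)$ is the Grothendieck group of finite $(H,G)$-bisets and composition is induced by the tensor product of bisets. Let $A$ be a Green biset functor over $\mathbb K\mathcal D$, that is, a $\mathbb K$-linear functor from $\mathbb K\mathcal D$ to $\mathbb K$-modules with bilinear products $A(G)\times A(H)\to A(G\times H)$, $(a,b)\mapsto a\times b$, and an element $\xi_A\in A(1)$, such that the products are associative and unital up to the canonical isomorphisms of groups and functorial in both variables. Each $A(G)$ is an algebra under $a\cdot b=A(\mathrm{Iso}^G_{\Delta(G)}\circ\mathrm{Res}^{G\times G}_{\Delta(G)})(a\times b)$, with unity $A(\mathrm{Inf}_1^G)(\xi_A)$. Assume that for every $G\in\mathcal D$ this algebra is a finite dimensional split semisimple commutative $\mathbb K$-algebra (i.e. isomorphic to $\mathbb K^n$ for some $n\ge 0$), and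 let $E_G$ be the set of its primitive idempotents. A group $H\in\mathcal D$ is an $MC$-group of $A$ if there is $e\in E_H$ such that $A(\mathrm{Res}^H_K)(e)=0$ for every proper subgroup $K<H$ and $A(\mathrm{Def}^H_{H/N})(e)=0$ for every non-trivial normal subgroup $N\unlhd H$. An ideal of $A$ is a biset subfunctor $F$ of $A$ such that, for all $G,H\in\mathcal D$, $a\times x\in F(G\times H)$ for $a\in A(G)$, $x\in F(H)$, and $x\times a\in F(G\times H)$ for $x\in F(G)$, $a\in A(H)$. Let $F$ be an ideal of $A$, and let $H\in\mathcal D$ be a minimal group for $F$, i.e. $F(H)\neq 0$ and $F(T)=0$ for every $T\in\mathcal D$ with $|T|<|H|$. Then $H$ is an $MC$-group of $A$. -/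

import Mathlib

open CategoryTheory MulOpposite
open scoped TensorProduct

universe u v w

/-! ### Finite bisets -/

/-- A finite `(H, G)`-biset: a finite set with commuting left `H`-action and right `G`-action. -/
structure Biset (H G : Type u) [Group H] [Group G] : Type (u + 1) where
  carrier : Type u
  [finite : Finite carrier]
  [left : MulAction H carrier]
  [right : MulAction Gᵐᵒᵖ carrier]
  [comm : SMulCommClass H Gᵐᵒᵖ carrier]

namespace Biset

attribute [instance] Biset.finite Biset.left Biset.right Biset.comm

section

variable {H G K L : Type u} [Group H] [Group G] [Group K] [Group L]

/-- Isomorphism of bisets: a biequivariant bijection. -/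
def Iso (U V : Biset H G) : Prop :=
  ∃ e : U.carrier ≃ V.carrier, (∀ (h : H) (x : U.carrier), e (h • x) = h • e x) ∧
    ∀ (g : G) (x : U.carrier), e (op g • x) = op g • e x

theorem Iso.refl (U : Biset H G) : Iso U U :=
  ⟨Equiv.refl _, fun _ _ => rfl, fun _ _ => rfl⟩

theorem Iso.symm {U V : Biset H G} : Iso U V → Iso V U := by
  rintro ⟨e, h1, h2⟩
  refine ⟨e.symm, fun h x => ?_, fun g x => ?_⟩
  · rw [Equiv.symm_apply_eq, h1, Equiv.apply_symm_apply]
  · rw [Equiv.symm_apply_eq, h2, Equiv.apply_symm_apply]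

theorem Iso.trans {U V W : Biset H G} : Iso U V → Iso V W → Iso U W := by
  rintro ⟨e, h1, h2⟩ ⟨f, h3, h4⟩
  exact ⟨e.trans f, fun h x => by simp [h1, h3], fun g x => by simp [h2, h4]⟩

instance setoid (H G : Type u) [Group H] [Group G] : Setoid (Biset H G) where
  r := Iso
  iseqv := ⟨Iso.refl, Iso.symm, Iso.trans⟩

/-- The empty biset. -/
def empty (H G : Type u) [Group H] [Group G] : Biset H G where
  carrier := PEmpty
  left :=
    { smul := fun _ x => x
      one_smul := fun _ => rfl
      mul_smul := fun _ _ _ => rfl }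
  right :=
    { smul := fun _ x => x
      one_smul := fun _ => rfl
      mul_smul := fun _ _ _ => rfl }
  comm := by
    refine @SMulCommClass.mk _ _ _ (_) (_) ?_
    exact fun _ _ _ => rfl

/-- Disjoint union of bisets. -/
def sum (U V : Biset H G) : Biset H G where
  carrier := U.carrier ⊕ V.carrier
  left :=
    { smul := fun h => Sum.map (h • ·) (h • ·)
      one_smul := by rintro (x | x) <;> simp [HSMul.hSMul] <;> exact one_smul _ _
      mul_smul := by rintro a b (x | x) <;> simp [HSMul.hSMul] <;> exact mul_smul _ _ _ }
  right :=
    { smul := fun h => Sum.map (h • ·) (h • ·)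
      one_smul := by rintro (x | x) <;> simp [HSMul.hSMul] <;> exact one_smul _ _
      mul_smul := by rintro a b (x | x) <;> simp [HSMul.hSMul] <;> exact mul_smul _ _ _ }
  comm := by
    refine @SMulCommClass.mk _ _ _ (_) (_) ?_
    rintro a b (x | x)
    · exact congrArg Sum.inl (smul_comm a b x)
    · exact congrArg Sum.inr (smul_comm a b x)

/-- The product of an `(H, G)`-biset and a `(K, L)`-biset, an `(H × K, G × L)`-biset. -/
def prod (U : Biset H G) (V : Biset K L) : Biset (H × K) (G × L) where
  carrier := U.carrier × V.carrier
  left :=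
    { smul := fun h x => (h.1 • x.1, h.2 • x.2)
      one_smul := fun x => Prod.ext (one_smul _ _) (one_smul _ _)
      mul_smul := fun _ _ x => Prod.ext (mul_smul _ _ _) (mul_smul _ _ _) }
  right :=
    { smul := fun g x => (op g.unop.1 • x.1, op g.unop.2 • x.2)
      one_smul := fun x => Prod.ext (one_smul _ _) (one_smul _ _)
      mul_smul := fun a b x =>
        Prod.ext (mul_smul (op a.unop.1) (op b.unop.1) _) (mul_smul (op a.unop.2) (op b.unop.2) _) }
  comm := by
    refine @SMulCommClass.mk _ _ _ (_) (_) ?_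
    exact fun _ _ x => Prod.ext (smul_comm _ _ _) (smul_comm _ _ _)

/-- The relation `(v · h, u) ∼ (v, h · u)` defining `V ×_H U`. -/
inductive TensorRel (V : Biset K H) (U : Biset H G) :
    V.carrier × U.carrier → V.carrier × U.carrier → Prop
  | mk (h : H) (v : V.carrier) (u : U.carrier) : TensorRel V U (op h • v, u) (v, h • u)

/-- The tensor product `V ×_H U` of a `(K, H)`-biset and an `(H, G)`-biset:
the quotient of `V × U` by the equivalence relation generated by `(v · h, u) ∼ (v, h · u)`. -/
def tensor (V : Biset K H) (U : Biset H G) : Biset K G where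
  carrier := Quot (TensorRel V U)
  finite := Finite.of_surjective _ Quot.mk_surjective
  left :=
    { smul := fun k => Quot.map (fun x => (k • x.1, x.2)) (by
        rintro _ _ ⟨h, a, b⟩
        simp only [smul_comm k (op h) a]
        exact TensorRel.mk h (k • a) b)
      one_smul := by
        rintro ⟨a, b⟩
        exact congrArg (Quot.mk _) (Prod.ext (one_smul _ _) rfl)
      mul_smul := by
        rintro k l ⟨a, b⟩
        exact congrArg (Quot.mk _) (Prod.ext (mul_smul _ _ _) rfl) }
  right :=
    { smul := fun g => Quot.map (fun x => (x.1, g • x.2)) (by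
        rintro _ _ ⟨h, a, b⟩
        simp only [← smul_comm h g b]
        exact TensorRel.mk h a (g • b))
      one_smul := by
        rintro ⟨a, b⟩
        exact congrArg (Quot.mk _) (Prod.ext rfl (one_smul _ _))
      mul_smul := by
        rintro k l ⟨a, b⟩
        exact congrArg (Quot.mk _) (Prod.ext rfl (mul_smul _ _ _)) }
  comm := by
    refine @SMulCommClass.mk _ _ _ (_) (_) ?_
    rintro k g ⟨a, b⟩
    rfl

/-- For `φ : K → G`, the set `G` as a `(K, G)`-biset: `K` acts on the left through `φ` and
`G` acts on the right by multiplication. -/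
def resHom [Finite G] (φ : K →* G) : Biset K G where
  carrier := G
  left := MulAction.compHom G φ
  right := Monoid.toOppositeMulAction
  comm := by
    refine @SMulCommClass.mk _ _ _ (_) (_) ?_
    exact fun a b x => (mul_assoc (φ a) x b.unop).symm

/-- For `φ : K → G`, the set `G` as a `(G, K)`-biset: `G` acts on the left by multiplication and
`K` acts on the right through `φ`. -/
def indHom [Finite G] (φ : K →* G) : Biset G K where
  carrier := G
  left := Monoid.toMulAction G
  right := MulAction.compHom G φ.op
  comm := by
    refine @SMulCommClass.mk _ _ _ (_) (_) ?_
    exact fun a b x => (mul_assoc a x (φ b.unop)).symm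

/-! #### Compatibility of the constructions with isomorphism -/

theorem Iso.sum {U U' V V' : Biset H G} : Iso U U' → Iso V V' → Iso (U.sum V) (U'.sum V') := by
  rintro ⟨e, h1, h2⟩ ⟨f, h3, h4⟩
  refine ⟨Equiv.sumCongr e f, ?_, ?_⟩
  · rintro h (x | x)
    · exact congrArg Sum.inl (h1 h x)
    · exact congrArg Sum.inr (h3 h x)
  · rintro h (x | x)
    · exact congrArg Sum.inl (h2 h x)
    · exact congrArg Sum.inr (h4 h x)

theorem sum_comm (U V : Biset H G) : Iso (U.sum V) (V.sum U) := by
  refine ⟨Equiv.sumComm _ _, ?_, ?_⟩ <;> rintro h (x | x) <;> rfl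

theorem sum_assoc (U V W : Biset H G) : Iso ((U.sum V).sum W) (U.sum (V.sum W)) := by
  refine ⟨Equiv.sumAssoc _ _ _, ?_, ?_⟩ <;> rintro h ((x | x) | x) <;> rfl

theorem empty_sum (U : Biset H G) : Iso ((empty H G).sum U) U := by
  refine ⟨Equiv.emptySum PEmpty _, ?_, ?_⟩ <;> rintro h (x | x) <;> first | exact x.elim | rfl

theorem Iso.prod {U U' : Biset H G} {V V' : Biset K L} :
    Iso U U' → Iso V V' → Iso (U.prod V) (U'.prod V') := by
  rintro ⟨e, h1, h2⟩ ⟨f, h3, h4⟩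
  exact ⟨Equiv.prodCongr e f, fun h x => Prod.ext (h1 _ _) (h3 _ _),
    fun h x => Prod.ext (h2 _ _) (h4 _ _)⟩

theorem sum_prod (U U' : Biset H G) (V : Biset K L) :
    Iso ((U.sum U').prod V) ((U.prod V).sum (U'.prod V)) := by
  refine ⟨Equiv.sumProdDistrib _ _ _, ?_, ?_⟩ <;> rintro h ⟨x | x, y⟩ <;> rfl

theorem prod_sum (U : Biset H G) (V V' : Biset K L) :
    Iso (U.prod (V.sum V')) ((U.prod V).sum (U.prod V')) := by
  refine ⟨Equiv.prodSumDistrib _ _ _, ?_, ?_⟩ <;> rintro h ⟨y, x | x⟩ <;> rfl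

theorem empty_prod (V : Biset K L) : Iso ((empty H G).prod V) (empty _ _) := by
  refine ⟨Equiv.pemptyProd _, ?_, ?_⟩ <;> rintro h ⟨x, y⟩ <;> exact x.elim

theorem prod_empty (U : Biset H G) : Iso (U.prod (empty K L)) (empty _ _) := by
  refine ⟨Equiv.prodPEmpty _, ?_, ?_⟩ <;> rintro h ⟨x, y⟩ <;> exact y.elim

/-- The class of `(v, u)` in `V ×_H U`. -/
def tmk (V : Biset K H) (U : Biset H G) (v : V.carrier) (u : U.carrier) :
    (V.tensor U).carrier :=
  Quot.mk _ (v, u)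

theorem tmk_smul (V : Biset K H) (U : Biset H G) (h : H) (v : V.carrier) (u : U.carrier) :
    tmk V U (op h • v) u = tmk V U v (h • u) :=
  Quot.sound (TensorRel.mk h v u)

/-- Functions out of `V ×_H U`. -/
def tlift {V : Biset K H} {U : Biset H G} {X : Type w} (f : V.carrier → U.carrier → X)
    (hf : ∀ (h : H) v u, f (op h • v) u = f v (h • u)) : (V.tensor U).carrier → X :=
  Quot.lift (fun p => f p.1 p.2) (by rintro _ _ ⟨h, v, u⟩; exact hf h v u)

theorem Iso.tensor {V V' : Biset K H} {U U' : Biset H G} :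
    Iso V V' → Iso U U' → Iso (V.tensor U) (V'.tensor U') := by
  rintro ⟨e, h1, h2⟩ ⟨f, h3, h4⟩
  refine ⟨⟨tlift (fun v u => tmk V' U' (e v) (f u)) fun h v u => by rw [h2, h3, tmk_smul],
    tlift (fun v u => tmk V U (e.symm v) (f.symm u)) fun h v u => ?_, ?_, ?_⟩, ?_, ?_⟩
  · have a : e.symm (op h • v) = op h • e.symm v := by simp [Equiv.symm_apply_eq, h2]
    have b : f.symm (h • u) = h • f.symm u := by simp [Equiv.symm_apply_eq, h3]
    rw [a, b, tmk_smul]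
  · rintro ⟨v, u⟩
    exact congrArg₂ (tmk V U) (e.symm_apply_apply v) (f.symm_apply_apply u)
  · rintro ⟨v, u⟩
    exact congrArg₂ (tmk V' U') (e.apply_symm_apply v) (f.apply_symm_apply u)
  · rintro k ⟨v, u⟩
    exact congrArg₂ (tmk V' U') (h1 k v) rfl
  · rintro k ⟨v, u⟩
    exact congrArg₂ (tmk V' U') rfl (h4 k u)

theorem sum_tensor (V V' : Biset K H) (U : Biset H G) :
    Iso ((V.sum V').tensor U) ((V.tensor U).sum (V'.tensor U)) := by
  refine ⟨⟨tlift (fun v u => v.elim (fun v => Sum.inl (tmk V U v u))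
      fun v => Sum.inr (tmk V' U v u)) ?_,
    Sum.elim (tlift (fun v u => tmk (V.sum V') U (Sum.inl v) u) ?_)
      (tlift (fun v u => tmk (V.sum V') U (Sum.inr v) u) ?_), ?_, ?_⟩, ?_, ?_⟩
  · rintro h (v | v) u
    · exact congrArg Sum.inl (tmk_smul V U h v u)
    · exact congrArg Sum.inr (tmk_smul V' U h v u)
  · exact fun h v u => tmk_smul (V.sum V') U h (Sum.inl v) u
  · exact fun h v u => tmk_smul (V.sum V') U h (Sum.inr v) u
  · rintro ⟨v | v, u⟩ <;> rfl
  · rintro (⟨v, u⟩ | ⟨v, u⟩) <;> rfl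
  · rintro k ⟨v | v, u⟩ <;> rfl
  · rintro k ⟨v | v, u⟩ <;> rfl

theorem tensor_sum (V : Biset K H) (U U' : Biset H G) :
    Iso (V.tensor (U.sum U')) ((V.tensor U).sum (V.tensor U')) := by
  refine ⟨⟨tlift (fun v u => u.elim (fun u => Sum.inl (tmk V U v u))
      fun u => Sum.inr (tmk V U' v u)) ?_,
    Sum.elim (tlift (fun v u => tmk V (U.sum U') v (Sum.inl u)) ?_)
      (tlift (fun v u => tmk V (U.sum U') v (Sum.inr u)) ?_), ?_, ?_⟩, ?_, ?_⟩
  · rintro h v (u | u)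
    · exact congrArg Sum.inl (tmk_smul V U h v u)
    · exact congrArg Sum.inr (tmk_smul V U' h v u)
  · exact fun h v u => tmk_smul V (U.sum U') h v (Sum.inl u)
  · exact fun h v u => tmk_smul V (U.sum U') h v (Sum.inr u)
  · rintro ⟨v, u | u⟩ <;> rfl
  · rintro (⟨v, u⟩ | ⟨v, u⟩) <;> rfl
  · rintro k ⟨v, u | u⟩ <;> rfl
  · rintro k ⟨v, u | u⟩ <;> rfl

theorem empty_tensor (U : Biset H G) : Iso ((empty K H).tensor U) (empty K G) := by
  refine ⟨⟨tlift (fun v _ => v) fun _ v _ => v.elim, fun v => v.elim, ?_, fun v => v.elim⟩, ?_, ?_⟩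
  · rintro ⟨v, u⟩
    exact v.elim
  · rintro k ⟨v, u⟩
    exact v.elim
  · rintro k ⟨v, u⟩
    exact v.elim

theorem tensor_empty (V : Biset K H) : Iso (V.tensor (empty H G)) (empty K G) := by
  refine ⟨⟨tlift (fun _ u => u) fun _ _ u => u.elim, fun v => v.elim, ?_, fun v => v.elim⟩, ?_, ?_⟩
  · rintro ⟨v, u⟩
    exact u.elim
  · rintro k ⟨v, u⟩
    exact u.elim
  · rintro k ⟨v, u⟩
    exact u.elim

theorem tensor_assoc (W : Biset L K) (V : Biset K H) (U : Biset H G) :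
    Iso ((W.tensor V).tensor U) (W.tensor (V.tensor U)) := by
  refine ⟨⟨tlift (fun x u => tlift (fun w v => tmk W (V.tensor U) w (tmk V U v u)) ?_ x) ?_,
    tlift (fun w x => tlift (fun v u => tmk (W.tensor V) U (tmk W V w v) u) ?_ x) ?_,
    ?_, ?_⟩, ?_, ?_⟩
  · exact fun k w v => tmk_smul W (V.tensor U) k w (tmk V U v u)
  · rintro h ⟨w, v⟩ u
    exact congrArg (tmk W (V.tensor U) w) (tmk_smul V U h v u)
  · exact fun h v u => tmk_smul (W.tensor V) U h (tmk W V w v) u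
  · rintro k w ⟨v, u⟩
    exact congrArg (fun z => tmk (W.tensor V) U z u) (tmk_smul W V k w v)
  · rintro ⟨⟨w, v⟩, u⟩; rfl
  · rintro ⟨w, ⟨v, u⟩⟩; rfl
  · rintro l ⟨⟨w, v⟩, u⟩; rfl
  · rintro l ⟨⟨w, v⟩, u⟩; rfl

theorem id_tensor [Finite H] (U : Biset H G) :
    Iso ((resHom (MonoidHom.id H)).tensor U) U := by
  refine ⟨⟨tlift (fun (h : H) u => h • u) ?_,
    fun u => tmk (resHom (MonoidHom.id H)) U (1 : H) u, ?_, ?_⟩, ?_, ?_⟩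
  · exact fun h v u => mul_smul (show H from v) h u
  · rintro ⟨h, u⟩
    change H at h
    refine (tmk_smul (resHom (MonoidHom.id H)) U h (1 : H) u).symm.trans ?_
    exact congrArg (fun z => tmk (resHom (MonoidHom.id H)) U z u) (one_mul h)
  · exact fun u => one_smul H u
  · rintro k ⟨h, u⟩
    change H at h
    exact mul_smul k h u
  · rintro g ⟨h, u⟩
    change H at h
    exact smul_comm h (op g) u

theorem tensor_id [Finite G] (U : Biset H G) :
    Iso (U.tensor (resHom (MonoidHom.id G))) U := by
  refine ⟨⟨tlift (fun u (g : G) => op g • u) ?_,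
    fun u => tmk U (resHom (MonoidHom.id G)) u (1 : G), ?_, ?_⟩, ?_, ?_⟩
  · exact fun h v u => (mul_smul (op (show G from u)) (op h) v).symm
  · rintro ⟨u, g⟩
    change G at g
    refine (tmk_smul U (resHom (MonoidHom.id G)) g u (1 : G)).trans ?_
    exact congrArg (tmk U (resHom (MonoidHom.id G)) u) (mul_one g)
  · exact fun u => one_smul Gᵐᵒᵖ u
  · rintro k ⟨u, g⟩
    change G at g
    exact (smul_comm k (op g) u).symm
  · rintro k ⟨u, g⟩
    change G at g
    exact mul_smul (op k) (op g) u

theorem resHom_tensor [Finite H] [Finite G] (φ : K →* H) (ψ : H →* G) :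
    Iso ((resHom φ).tensor (resHom ψ)) (resHom (ψ.comp φ)) := by
  refine ⟨⟨tlift (fun (h : H) (g : G) => ψ h * g) ?_,
    fun (g : G) => tmk (resHom φ) (resHom ψ) (1 : H) g, ?_, ?_⟩, ?_, ?_⟩
  · intro h v u
    change H at v
    change G at u
    change ψ (v * h) * u = ψ v * (ψ h * u)
    rw [map_mul, mul_assoc]
  · rintro ⟨h, g⟩
    change H at h
    change G at g
    refine (tmk_smul (resHom φ) (resHom ψ) h (1 : H) g).symm.trans ?_
    exact congrArg (fun z => tmk (resHom φ) (resHom ψ) z g) (one_mul h)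
  · intro g
    change G at g
    change ψ 1 * g = g
    rw [map_one, one_mul]
  · rintro k ⟨h, g⟩
    change H at h
    change G at g
    change ψ (φ k * h) * g = ψ (φ k) * (ψ h * g)
    rw [map_mul, mul_assoc]
  · rintro k ⟨h, g⟩
    change H at h
    change G at g
    exact (mul_assoc (ψ h) g k).symm

theorem resHom_prod [Finite H] [Finite G] (φ : K →* H) (ψ : L →* G) :
    Iso ((resHom φ).prod (resHom ψ)) (resHom (φ.prodMap ψ)) :=
  ⟨Equiv.refl _, fun _ _ => rfl, fun _ _ => rfl⟩

theorem indHom_equiv [Finite H] [Finite G] (e : H ≃* G) :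
    Iso (indHom e.toMonoidHom) (resHom e.symm.toMonoidHom) := by
  refine ⟨e.symm.toEquiv, fun g x => ?_, fun h x => ?_⟩
  · change G at x
    exact map_mul e.symm g x
  · change G at x
    change e.symm (x * e h) = e.symm x * h
    rw [map_mul, e.symm_apply_apply]

end

end Biset

/-! ### The groups `B(H, G)` and `RB(H, G)` -/

/-- Isomorphism classes of finite `(H, G)`-bisets. -/
def BisetClass (H G : Type u) [Group H] [Group G] : Type (u + 1) :=
  Quotient (Biset.setoid H G)

namespace BisetClass

variable {H G K L : Type u} [Group H] [Group G] [Group K] [Group L]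

/-- The isomorphism class of a biset. -/
def mk (U : Biset H G) : BisetClass H G := Quotient.mk _ U

theorem sound {U V : Biset H G} (h : Biset.Iso U V) : mk U = mk V := Quotient.sound h

instance : Zero (BisetClass H G) := ⟨mk (Biset.empty H G)⟩

instance : Add (BisetClass H G) :=
  ⟨Quotient.map₂ Biset.sum fun _ _ h _ _ h' => Biset.Iso.sum h h'⟩

/-- Isomorphism classes form a commutative monoid under disjoint union. -/
instance : AddCommMonoid (BisetClass H G) where
  add_assoc := by rintro ⟨U⟩ ⟨V⟩ ⟨W⟩; exact sound (Biset.sum_assoc U V W)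
  zero_add := by rintro ⟨U⟩; exact sound (Biset.empty_sum U)
  add_zero := by rintro ⟨U⟩; exact sound ((Biset.sum_comm _ _).trans (Biset.empty_sum U))
  add_comm := by rintro ⟨U⟩ ⟨V⟩; exact sound (Biset.sum_comm U V)
  nsmul := nsmulRec

/-- The biadditive map `([V], [U]) ↦ [V ×_H U]`. -/
def tensor : BisetClass K H →+ BisetClass H G →+ BisetClass K G where
  toFun V :=
    { toFun := Quotient.map₂ Biset.tensor (fun _ _ h _ _ h' => Biset.Iso.tensor h h') V
      map_zero' := by
        induction V using Quotient.ind with | _ V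
        exact sound (Biset.tensor_empty V)
      map_add' := by
        induction V using Quotient.ind with | _ V
        rintro ⟨U⟩ ⟨U'⟩
        exact sound (Biset.tensor_sum V U U') }
  map_zero' := by ext ⟨U⟩; exact sound (Biset.empty_tensor U)
  map_add' := by rintro ⟨V⟩ ⟨V'⟩; ext ⟨U⟩; exact sound (Biset.sum_tensor V V' U)

/-- The biadditive map `([U], [V]) ↦ [U × V]`. -/
def prod : BisetClass H G →+ BisetClass K L →+ BisetClass (H × K) (G × L) where
  toFun V :=
    { toFun := Quotient.map₂ Biset.prod (fun _ _ h _ _ h' => Biset.Iso.prod h h') V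
      map_zero' := by
        induction V using Quotient.ind with | _ V
        exact sound (Biset.prod_empty V)
      map_add' := by
        induction V using Quotient.ind with | _ V
        rintro ⟨U⟩ ⟨U'⟩
        exact sound (Biset.prod_sum V U U') }
  map_zero' := by ext ⟨U⟩; exact sound (Biset.empty_prod U)
  map_add' := by rintro ⟨V⟩ ⟨V'⟩; ext ⟨U⟩; exact sound (Biset.sum_prod V V' U)

theorem tensor_assoc (W : BisetClass L K) (V : BisetClass K H) (U : BisetClass H G) :
    tensor (tensor W V) U = tensor W (tensor V U) := by
  induction W using Quotient.ind with | _ W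
  induction V using Quotient.ind with | _ V
  induction U using Quotient.ind with | _ U
  exact sound (Biset.tensor_assoc W V U)

end BisetClass

/-- `R ⊗_ℤ (Grothendieck group of M)`. -/
abbrev GrothendieckModule (R : Type v) [CommRing R] (M : Type w) [AddCommMonoid M] :
    Type (max v w) :=
  R ⊗[ℤ] Algebra.GrothendieckAddGroup M

namespace GrothendieckModule

variable {R : Type v} [CommRing R] {M N P : Type w}
  [AddCommMonoid M] [AddCommMonoid N] [AddCommMonoid P]

variable (R) in
/-- The canonical map from a commutative monoid to the linearized Grothendieck group. -/
noncomputable def of : M →+ GrothendieckModule R M where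
  toFun m := (1 : R) ⊗ₜ[ℤ] Algebra.GrothendieckAddGroup.of m
  map_zero' := by simp
  map_add' := by simp [TensorProduct.tmul_add]

/-- The linear extension of an additive map. -/
noncomputable def lift {X : Type*} [AddCommGroup X] [Module R X] (f : M →+ X) :
    GrothendieckModule R M →ₗ[R] X :=
  LinearMap.liftBaseChange R (Algebra.GrothendieckAddGroup.lift f).toIntLinearMap

theorem lift_of {X : Type*} [AddCommGroup X] [Module R X] (f : M →+ X) (m : M) :
    lift (R := R) f (of R m) = f m := by
  have h : Algebra.GrothendieckAddGroup.lift f (Algebra.GrothendieckAddGroup.of m) = f m :=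
    DFunLike.congr_fun (Algebra.GrothendieckAddGroup.lift.symm_apply_apply f) m
  change (1 : R) • Algebra.GrothendieckAddGroup.lift f (Algebra.GrothendieckAddGroup.of m) = f m
  rw [h, one_smul]

theorem hom_ext {X : Type*} [AddCommGroup X] [Module R X] {f g : GrothendieckModule R M →ₗ[R] X}
    (h : ∀ m, f (of R m) = g (of R m)) : f = g := by
  apply (LinearMap.liftBaseChangeEquiv R).symm.injective
  apply LinearMap.toAddMonoidHom_injective
  apply Algebra.GrothendieckAddGroup.lift.symm.injective
  ext m
  exact h m

/-- The bilinear extension of a biadditive map. -/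
noncomputable def lift₂ (f : M →+ N →+ P) :
    GrothendieckModule R M →ₗ[R] GrothendieckModule R N →ₗ[R] GrothendieckModule R P :=
  lift
    { toFun := fun m => lift ((of R).comp (f m))
      map_zero' := hom_ext fun n => by simp [lift_of]
      map_add' := fun m m' => hom_ext fun n => by simp [lift_of] }

theorem lift₂_of (f : M →+ N →+ P) (m : M) (n : N) :
    lift₂ (R := R) f (of R m) (of R n) = of R (f m n) := by
  simp [lift₂, lift_of]

end GrothendieckModule

/-- `RB(H, G) = R ⊗_ℤ B(H, G)`, where `B(H, G)` is the Grothendieck group of the category of finite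
`(H, G)`-bisets. -/
abbrev BurnsideModule (R : Type v) [CommRing R] (H G : Type u) [Group H] [Group G] :
    Type (max v (u + 1)) :=
  GrothendieckModule R (BisetClass H G)

namespace BurnsideModule

variable {R : Type v} [CommRing R] {H G K L : Type u} [Group H] [Group G] [Group K] [Group L]

variable (R) in
/-- The class of a biset in `RB(H, G)`. -/
noncomputable def of (U : Biset H G) : BurnsideModule R H G :=
  GrothendieckModule.of R (BisetClass.mk U)

variable (R) in
theorem of_eq {U V : Biset H G} (h : U.Iso V) : of R U = of R V :=
  congrArg (GrothendieckModule.of R) (BisetClass.sound h)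

/-- Composition `RB(K, H) × RB(H, G) → RB(K, G)`, the bilinear extension of the tensor product. -/
noncomputable def comp :
    BurnsideModule R K H →ₗ[R] BurnsideModule R H G →ₗ[R] BurnsideModule R K G :=
  GrothendieckModule.lift₂ BisetClass.tensor

/-- The bilinear extension of the product of bisets. -/
noncomputable def prod : BurnsideModule R H G →ₗ[R] BurnsideModule R K L →ₗ[R]
    BurnsideModule R (H × K) (G × L) :=
  GrothendieckModule.lift₂ BisetClass.prod

theorem hom_ext {X : Type*} [AddCommGroup X] [Module R X] {f g : BurnsideModule R H G →ₗ[R] X}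
    (h : ∀ U, f (of R U) = g (of R U)) : f = g :=
  GrothendieckModule.hom_ext fun m => by
    induction m using Quotient.ind with | _ U
    exact h U

theorem comp_of (V : Biset K H) (U : Biset H G) :
    comp (of R V) (of R U) = of R (V.tensor U) :=
  GrothendieckModule.lift₂_of _ _ _

theorem prod_of (U : Biset H G) (V : Biset K L) :
    prod (of R U) (of R V) = of R (U.prod V) :=
  GrothendieckModule.lift₂_of _ _ _

theorem comp_assoc (c : BurnsideModule R L K) (b : BurnsideModule R K H)
    (a : BurnsideModule R H G) : comp (comp c b) a = comp c (comp b a) := by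
  refine LinearMap.congr_fun (f := comp (comp c b)) (g := comp c ∘ₗ comp b)
    (hom_ext fun U => ?_) a
  refine LinearMap.congr_fun (f := comp.flip (of R U) ∘ₗ comp c)
    (g := comp c ∘ₗ comp.flip (of R U)) (hom_ext fun V => ?_) b
  refine LinearMap.congr_fun (f := comp.flip (of R U) ∘ₗ comp.flip (of R V))
    (g := comp.flip (comp (of R V) (of R U))) (hom_ext fun W => ?_) c
  simp only [LinearMap.comp_apply, LinearMap.flip_apply, comp_of]
  exact of_eq R (Biset.tensor_assoc W V U)

theorem id_comp [Finite H] (a : BurnsideModule R H G) :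
    comp (of R (Biset.resHom (MonoidHom.id H))) a = a :=
  LinearMap.congr_fun (g := LinearMap.id) (hom_ext fun U =>
    (comp_of _ _).trans (of_eq R (Biset.id_tensor U))) a

theorem comp_id [Finite G] (a : BurnsideModule R H G) :
    comp a (of R (Biset.resHom (MonoidHom.id G))) = a :=
  LinearMap.congr_fun (f := comp.flip _) (g := LinearMap.id) (hom_ext fun U =>
    (comp_of _ _).trans (of_eq R (Biset.tensor_id U))) a

end BurnsideModule

/-! ### The biset category -/

/-- A non-empty class of finite groups closed under subquotients (in particular under isomorphism)
and cartesian products. -/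
class IsBisetClass (D : FiniteGrp.{u} → Prop) : Prop where
  nonempty : ∃ G, D G
  subquotient : ∀ {G K : FiniteGrp.{u}} (S : Subgroup G) (f : S →* K),
    Function.Surjective f → D G → D K
  prod : ∀ {G H : FiniteGrp.{u}}, D G → D H → D (FiniteGrp.of (G × H))

/-- The objects of the biset category `R𝒟`: the finite groups in the class `D`. -/
structure BisetCat (R : Type v) [CommRing R] (D : FiniteGrp.{u} → Prop) where
  grp : FiniteGrp.{u}
  mem : D grp

namespace BisetCat

variable {R : Type v} [CommRing R] {D : FiniteGrp.{u} → Prop}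

/-- In `R𝒟`, `Hom(G, H) = RB(H, G)`, with composition induced by the tensor product of bisets. -/
noncomputable instance : Category.{max v (u + 1)} (BisetCat R D) where
  Hom G H := BurnsideModule R H.grp G.grp
  id G := BurnsideModule.of R (Biset.resHom (MonoidHom.id G.grp))
  comp f g := BurnsideModule.comp g f
  id_comp f := BurnsideModule.comp_id f
  comp_id f := BurnsideModule.id_comp f
  assoc f g h := (BurnsideModule.comp_assoc h g f).symm

noncomputable instance : Preadditive (BisetCat R D) where
  homGroup G H := inferInstanceAs (AddCommGroup (BurnsideModule R H.grp G.grp))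
  add_comp _ _ _ f f' g := LinearMap.map_add (BurnsideModule.comp g) f f'
  comp_add _ _ _ f g g' := LinearMap.map_add₂ BurnsideModule.comp g g' f

noncomputable instance : Linear R (BisetCat R D) where
  homModule G H := inferInstanceAs (Module R (BurnsideModule R H.grp G.grp))
  smul_comp _ _ _ r f g := LinearMap.map_smul (BurnsideModule.comp g) r f
  comp_smul _ _ _ f r g := LinearMap.map_smul₂ BurnsideModule.comp r g f

/-! #### Elementary morphisms -/

/-- The morphism given by a biset. -/
noncomputable def ofBiset {G H : BisetCat R D} (U : Biset H.grp G.grp) : G ⟶ H :=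
  BurnsideModule.of R U

/-- The morphism `G ⟶ K` given by the `(K, G)`-biset `G`, for `φ : K → G`. -/
noncomputable def resMor {K G : BisetCat R D} (φ : K.grp →* G.grp) : G ⟶ K :=
  ofBiset (Biset.resHom φ)

/-- The morphism `K ⟶ G` given by the `(G, K)`-biset `G`, for `φ : K → G`. -/
noncomputable def indMor {K G : BisetCat R D} (φ : K.grp →* G.grp) : K ⟶ G :=
  ofBiset (Biset.indHom φ)

/-- `Iso(φ)`, the `(H, G)`-biset `H`, for an isomorphism `φ : G → H`. -/
noncomputable def isoMor {G H : BisetCat R D} (φ : G.grp ≃* H.grp) : G ⟶ H :=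
  indMor φ.toMonoidHom

theorem resMor_id (G : BisetCat R D) : resMor (MonoidHom.id G.grp) = 𝟙 G := rfl

theorem resMor_comp {G H K : BisetCat R D} (φ : K.grp →* H.grp) (ψ : H.grp →* G.grp) :
    resMor ψ ≫ resMor φ = resMor (R := R) (ψ.comp φ) :=
  (BurnsideModule.comp_of _ _).trans (BurnsideModule.of_eq R (Biset.resHom_tensor φ ψ))

theorem isoMor_eq {G H : BisetCat R D} (φ : G.grp ≃* H.grp) :
    isoMor φ = resMor φ.symm.toMonoidHom :=
  BurnsideModule.of_eq R (Biset.indHom_equiv φ)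

variable [IsBisetClass D]

/-- A subgroup of a group of `D`, as an object. -/
def sub (G : BisetCat R D) (S : Subgroup G.grp) : BisetCat R D where
  grp := FiniteGrp.of S
  mem := IsBisetClass.subquotient S (MonoidHom.id S) Function.surjective_id G.mem

/-- A quotient of a group of `D`, as an object. -/
def quot (G : BisetCat R D) (N : Subgroup G.grp) [N.Normal] : BisetCat R D where
  grp := FiniteGrp.of (G.grp ⧸ N)
  mem := IsBisetClass.subquotient ⊤ ((QuotientGroup.mk' N).comp (Subgroup.subtype ⊤))
    ((QuotientGroup.mk'_surjective N).comp fun x => ⟨⟨x, trivial⟩, rfl⟩) G.mem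

/-- The direct product of two groups of `D`, as an object. -/
def prod (G H : BisetCat R D) : BisetCat R D where
  grp := FiniteGrp.of (G.grp × H.grp)
  mem := IsBisetClass.prod G.mem H.mem

variable (R D) in
/-- The trivial group, as an object. -/
def one : BisetCat R D where
  grp := FiniteGrp.of PUnit
  mem := by
    obtain ⟨G, hG⟩ := IsBisetClass.nonempty (D := D)
    exact IsBisetClass.subquotient (⊤ : Subgroup G) (1 : (⊤ : Subgroup G) →* PUnit)
      (fun _ => ⟨1, rfl⟩) hG

/-- The product of two morphisms, the bilinear extension of the product of bisets. -/
noncomputable def prodMor {G G' H H' : BisetCat R D} (f : G ⟶ G') (g : H ⟶ H') :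
    G.prod H ⟶ G'.prod H' :=
  BurnsideModule.prod (R := R) (H := G'.grp) (G := G.grp) (K := H'.grp) (L := H.grp) f g

/-- The inclusion `S → G` of a subgroup. -/
def subHom (G : BisetCat R D) (S : Subgroup G.grp) : (G.sub S).grp →* G.grp := S.subtype

/-- The projection `G → G/N`. -/
def quotHom (G : BisetCat R D) (N : Subgroup G.grp) [N.Normal] : G.grp →* (G.quot N).grp :=
  QuotientGroup.mk' N

/-- The homomorphism `G → 1`. -/
def oneHom (G : BisetCat R D) : G.grp →* (one R D).grp := (1 : G.grp →* PUnit)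

/-- The homomorphism `φ × ψ`. -/
def prodHom {G G' H H' : BisetCat R D} (φ : G'.grp →* G.grp) (ψ : H'.grp →* H.grp) :
    (G'.prod H').grp →* (G.prod H).grp := φ.prodMap ψ

/-- Restriction `Res^G_S`, the `(S, G)`-biset `G`. -/
noncomputable def res (G : BisetCat R D) (S : Subgroup G.grp) : G ⟶ G.sub S :=
  resMor (G.subHom S)

/-- Deflation `Def^G_{G/N}`, the `(G/N, G)`-biset `G/N`. -/
noncomputable def defl (G : BisetCat R D) (N : Subgroup G.grp) [N.Normal] : G ⟶ G.quot N :=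
  indMor (G.quotHom N)

/-- Inflation `Inf^G_1`, the one-point `(G, 1)`-biset. -/
noncomputable def infOne (G : BisetCat R D) : one R D ⟶ G :=
  resMor G.oneHom

/-- The diagonal homomorphism `g ↦ (g, g)`. -/
def diag (G : BisetCat R D) : G.grp →* (G.prod G).grp :=
  (MonoidHom.id G.grp).prod (MonoidHom.id G.grp)

theorem diag_injective (G : BisetCat R D) : Function.Injective G.diag :=
  fun _ _ h => congrArg Prod.fst h

/-- The isomorphism `Δ(G) ≃ G`, where `Δ(G)` is the diagonal subgroup of `G × G`. -/
noncomputable def diagIso (G : BisetCat R D) : ((G.prod G).sub G.diag.range).grp ≃* G.grp :=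
  (MonoidHom.ofInjective G.diag_injective).symm

/-- `Iso^G_{Δ(G)} ∘ Res^{G × G}_{Δ(G)}`. -/
noncomputable def diagMor (G : BisetCat R D) : G.prod G ⟶ G :=
  (G.prod G).res G.diag.range ≫ isoMor G.diagIso

/-- The canonical isomorphism `G × (H × K) ≃ (G × H) × K`. -/
def assocIso (G H K : BisetCat R D) : (G.prod (H.prod K)).grp ≃* ((G.prod H).prod K).grp :=
  (MulEquiv.prodAssoc (M := G.grp) (N := H.grp) (P := K.grp)).symm

/-- The canonical isomorphism `1 × G ≃ G`. -/
def oneProdIso (G : BisetCat R D) : ((one R D).prod G).grp ≃* G.grp :=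
  MulEquiv.uniqueProd (M := G.grp) (N := PUnit)

/-- The canonical isomorphism `G × 1 ≃ G`. -/
def prodOneIso (G : BisetCat R D) : (G.prod (one R D)).grp ≃* G.grp :=
  MulEquiv.prodUnique (M := G.grp) (N := PUnit)

theorem prodMor_resMor {G G' H H' : BisetCat R D} (φ : G'.grp →* G.grp) (ψ : H'.grp →* H.grp) :
    prodMor (resMor φ) (resMor ψ) =
      resMor (prodHom φ ψ) :=
  (BurnsideModule.prod_of _ _).trans (BurnsideModule.of_eq R (Biset.resHom_prod φ ψ))

theorem diagMor_eq (G : BisetCat R D) : G.diagMor = resMor G.diag := by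
  rw [diagMor, isoMor_eq, res, resMor_comp]
  rfl

end BisetCat

/-! ### Green biset functors -/

/-- A Green biset functor over `R𝒟`: an `R`-linear functor from `R𝒟` to `R`-modules with bilinear
products `A(G) × A(H) → A(G × H)` and an element of `A(1)`, which are associative, unital and
functorial. -/
structure GreenBisetFunctor (R : Type v) [CommRing R] (D : FiniteGrp.{u} → Prop)
    [IsBisetClass D] where
  functor : BisetCat R D ⥤ ModuleCat.{w} R
  [additive : functor.Additive]
  [linear : functor.Linear R]
  cross (G H : BisetCat R D) :
    functor.obj G →ₗ[R] functor.obj H →ₗ[R] functor.obj (G.prod H)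
  unit : functor.obj (BisetCat.one R D)
  cross_assoc (G H K : BisetCat R D) (a : functor.obj G) (b : functor.obj H)
    (c : functor.obj K) :
    cross (G.prod H) K (cross G H a b) c =
      functor.map (BisetCat.isoMor (BisetCat.assocIso G H K))
        (cross G (H.prod K) a (cross H K b c))
  unit_cross (G : BisetCat R D) (a : functor.obj G) :
    a = functor.map (BisetCat.isoMor G.oneProdIso) (cross _ G unit a)
  cross_unit (G : BisetCat R D) (a : functor.obj G) :
    a = functor.map (BisetCat.isoMor G.prodOneIso) (cross G _ a unit)
  map_cross {G G' H H' : BisetCat R D} (f : G ⟶ G') (g : H ⟶ H') (a : functor.obj G)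
    (b : functor.obj H) :
    functor.map (BisetCat.prodMor f g) (cross G H a b) =
      cross G' H' (functor.map f a) (functor.map g b)

namespace GreenBisetFunctor

variable {R : Type v} [CommRing R] {D : FiniteGrp.{u} → Prop} [IsBisetClass D]
  (A : GreenBisetFunctor.{u, v, w} R D)

/-- The evaluation `A(G)`. -/
def ev (G : BisetCat R D) : Type w := A.functor.obj G

instance (G : BisetCat R D) : AddCommGroup (A.ev G) :=
  inferInstanceAs (AddCommGroup (A.functor.obj G))

instance (G : BisetCat R D) : Module R (A.ev G) :=
  inferInstanceAs (Module R (A.functor.obj G))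

/-- The map `A(f) : A(G) → A(H)` induced by a morphism `f : G ⟶ H` of `R𝒟`. -/
def map {G H : BisetCat R D} (f : G ⟶ H) : A.ev G →ₗ[R] A.ev H := (A.functor.map f).hom

/-- The product `× : A(G) × A(H) → A(G × H)`. -/
def times {G H : BisetCat R D} : A.ev G →ₗ[R] A.ev H →ₗ[R] A.ev (G.prod H) := A.cross G H

/-- The identity element `ξ ∈ A(1)`. -/
def ξ : A.ev (BisetCat.one R D) := A.unit

theorem map_id {G : BisetCat R D} (a : A.ev G) : A.map (𝟙 G) a = a := by
  change A.functor.map (𝟙 G) a = a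
  rw [A.functor.map_id]; rfl

theorem map_map {G H K : BisetCat R D} (f : G ⟶ H) (g : H ⟶ K) (a : A.ev G) :
    A.map g (A.map f a) = A.map (f ≫ g) a := by
  change A.functor.map g (A.functor.map f a) = A.functor.map (f ≫ g) a
  rw [A.functor.map_comp]; rfl

theorem map_times {G G' H H' : BisetCat R D} (f : G ⟶ G') (g : H ⟶ H') (a : A.ev G)
    (b : A.ev H) : A.times (A.map f a) (A.map g b) = A.map (BisetCat.prodMor f g) (A.times a b) :=
  (A.map_cross f g a b).symm

/-- The product `a · b = A(Iso^G_{Δ(G)} ∘ Res^{G × G}_{Δ(G)})(a × b)` on `A(G)`. -/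
noncomputable instance (G : BisetCat R D) : Mul (A.ev G) :=
  ⟨fun a b => A.map G.diagMor (A.times a b)⟩

/-- The unit `A(Inf^G_1)(ξ)` of `A(G)`. -/
noncomputable instance (G : BisetCat R D) : One (A.ev G) :=
  ⟨A.map G.infOne A.ξ⟩

theorem mul_def {G : BisetCat R D} (a b : A.ev G) : a * b = A.map G.diagMor (A.times a b) := rfl

theorem one_def {G : BisetCat R D} : (1 : A.ev G) = A.map G.infOne A.ξ := rfl

protected theorem mul_assoc' {G : BisetCat R D} (a b c : A.ev G) : a * b * c = a * (b * c) := by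
  have h1 : a * b * c = A.map G.diagMor (A.times (A.map G.diagMor (A.times a b)) (A.map (𝟙 G) c)) := by
    rw [map_id]; rfl
  have h2 : a * (b * c) = A.map G.diagMor (A.times (A.map (𝟙 G) a) (A.map G.diagMor (A.times b c))) := by
    rw [map_id]; rfl
  have h3 : A.times (A.times a b) c = A.map _ (A.times a (A.times b c)) := A.cross_assoc G G G a b c
  rw [h1, h2, map_times, map_times, h3, map_map, map_map, map_map, BisetCat.isoMor_eq,
    BisetCat.diagMor_eq, ← BisetCat.resMor_id, BisetCat.prodMor_resMor, BisetCat.prodMor_resMor,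
    BisetCat.resMor_comp, BisetCat.resMor_comp, BisetCat.resMor_comp]
  rfl

protected theorem one_mul' {G : BisetCat R D} (a : A.ev G) : 1 * a = a := by
  have h1 : 1 * a = A.map G.diagMor (A.times (A.map G.infOne A.ξ) (A.map (𝟙 G) a)) := by
    rw [map_id]; rfl
  have h2 : a = A.map _ (A.times A.ξ a) := A.unit_cross G a
  rw [h1, map_times, map_map]
  conv_rhs => rw [h2]
  rw [BisetCat.isoMor_eq, BisetCat.diagMor_eq, ← BisetCat.resMor_id, BisetCat.infOne,
    BisetCat.prodMor_resMor, BisetCat.resMor_comp]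
  rfl

protected theorem mul_one' {G : BisetCat R D} (a : A.ev G) : a * 1 = a := by
  have h1 : a * 1 = A.map G.diagMor (A.times (A.map (𝟙 G) a) (A.map G.infOne A.ξ)) := by
    rw [map_id]; rfl
  have h2 : a = A.map _ (A.times a A.ξ) := A.cross_unit G a
  rw [h1, map_times, map_map]
  conv_rhs => rw [h2]
  rw [BisetCat.isoMor_eq, BisetCat.diagMor_eq, ← BisetCat.resMor_id, BisetCat.infOne,
    BisetCat.prodMor_resMor, BisetCat.resMor_comp]
  rfl

noncomputable instance (G : BisetCat R D) : Ring (A.ev G) where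
  __ := (inferInstance : AddCommGroup (A.ev G))
  mul_assoc := A.mul_assoc'
  one_mul := A.one_mul'
  mul_one := A.mul_one'
  left_distrib a b c := by simp only [mul_def, map_add]
  right_distrib a b c := by simp only [mul_def, map_add, LinearMap.add_apply]
  zero_mul a := by simp only [mul_def, map_zero, LinearMap.zero_apply]
  mul_zero a := by simp only [mul_def, map_zero]

/-- `A(G)` is an `R`-algebra. -/
noncomputable instance (G : BisetCat R D) : Algebra R (A.ev G) :=
  Algebra.ofModule
    (fun r a b => by simp only [mul_def, map_smul, LinearMap.smul_apply])
    (fun r a b => by simp only [mul_def, map_smul])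

/-- A two-sided ideal of `A`: a biset subfunctor `I` with `A(G) × I(H) ⊆ I(G × H)` and
`I(G) × A(H) ⊆ I(G × H)`. -/
structure Ideal where
  obj (G : BisetCat R D) : Submodule R (A.ev G)
  map_mem {G H : BisetCat R D} (f : G ⟶ H) {x : A.ev G} : x ∈ obj G → A.map f x ∈ obj H
  times_mem_left {G H : BisetCat R D} (a : A.ev G) {x : A.ev H} :
    x ∈ obj H → A.times a x ∈ obj (G.prod H)
  times_mem_right {G H : BisetCat R D} {x : A.ev G} (a : A.ev H) :
    x ∈ obj G → A.times x a ∈ obj (G.prod H)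

/-- `H` is a minimal group for the ideal `F`: `F(H) ≠ 0`, and `F(T) = 0` whenever `|T| < |H|`. -/
def Ideal.IsMinimalGroup {A : GreenBisetFunctor.{u, v, w} R D} (F : A.Ideal)
    (H : BisetCat R D) : Prop :=
  F.obj H ≠ ⊥ ∧ ∀ T : BisetCat R D, Nat.card T.grp < Nat.card H.grp → F.obj T = ⊥

/-- Primitive idempotents: non-zero idempotents that are not the sum of two non-zero orthogonal
idempotents. -/
def IsPrimitiveIdempotent {S : Type*} [Ring S] (e : S) : Prop :=
  e ≠ 0 ∧ IsIdempotentElem e ∧ ∀ f g : S, IsIdempotentElem f → IsIdempotentElem g →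
    f * g = 0 → g * f = 0 → e = f + g → f = 0 ∨ g = 0

/-- The set `E_G` of primitive idempotents of `A(G)`. -/
def E (G : BisetCat R D) : Set (A.ev G) := {e | IsPrimitiveIdempotent e}

/-- The elements of `E_H` whose restriction to every proper subgroup is zero. -/
def ERes (H : BisetCat R D) : Set (A.ev H) :=
  {e | e ∈ A.E H ∧ ∀ K : Subgroup H.grp, K < ⊤ → A.map (H.res K) e = 0}

/-- The elements of `E_H` whose deflation to `H/N` is zero for every non-trivial `N ⊴ H`. -/
def EDef (H : BisetCat R D) : Set (A.ev H) :=
  {e | e ∈ A.E H ∧ ∀ (N : Subgroup H.grp) [N.Normal], N ≠ ⊥ → A.map (H.defl N) e = 0}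

/-- `H` is an `MC`-group of `A`. -/
def IsMCGroup (H : BisetCat R D) : Prop := (A.ERes H ∩ A.EDef H).Nonempty

/-- Every `A(G)` is a finite dimensional split semisimple commutative `𝕂`-algebra, that is,
isomorphic as a `𝕂`-algebra to a product of finitely many copies of `𝕂`. -/
def IsSplitSemisimpleCommutative {𝕂 : Type v} [Field 𝕂] (A : GreenBisetFunctor.{u, v, w} 𝕂 D) :
    Prop :=
  ∀ G : BisetCat 𝕂 D, ∃ n : ℕ, Nonempty (A.ev G ≃ₐ[𝕂] (Fin n → 𝕂))

end GreenBisetFunctor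

/-! ### Primitive idempotents of split semisimple commutative algebras. -/

namespace GreenBisetFunctor

/-! An element that witnesses the `MC` property can be found inside `F(H)` itself.

The algebra product on `A(H)` is the cross product followed by the map induced by a morphism of the
biset category. An ideal is stable under both operations, so `F(H)` is closed under multiplication
by `A(H)` (`Ideal.mul_mem`). Since `A(H)` is isomorphic to `𝕂^n`, a non-zero ideal of it contains a
coordinate idempotent: if the `i`-th coordinate of `x` is non-zero, multiplying `x` by its inverse
placed at position `i` gives the `i`-th coordinate vector. Coordinate vectors are primitive
idempotents, so `F(H)` contains some `e` in `E_H` (`exists_isPrimitiveIdempotent_mem`).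

Because `F` is a subfunctor, every morphism from `H` to `T` sends `e` into `F(T)`, which vanishes by
minimality once `|T| < |H|`. Proper subgroups of `H` and quotients of `H` by non-trivial normal
subgroups are such groups `T`, so this one `e` is killed by all the restrictions and all the
deflations that define an `MC`-group. -/

/-- Primitivity involves only the ring operations, so an orthogonal decomposition of `φ e` pulls
back along `φ.symm` to one of `e`. This carries the coordinate idempotents of `𝕂^n` over to `A(H)`.
-/
theorem IsPrimitiveIdempotent.map_ringEquiv {S T : Type*} [Ring S] [Ring T] (φ : S ≃+* T) {e : S}
    (he : IsPrimitiveIdempotent e) : IsPrimitiveIdempotent (φ e) := by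
  obtain ⟨h0, h1, h2⟩ := he
  refine ⟨by simpa using h0, h1.map φ, fun f g hf hg hfg hgf h => ?_⟩
  have key := h2 (φ.symm f) (φ.symm g) (hf.map φ.symm) (hg.map φ.symm)
    (by rw [← map_mul, hfg, map_zero]) (by rw [← map_mul, hgf, map_zero])
    (by rw [← map_add, ← h, φ.symm_apply_apply])
  simpa using key

/-- In an orthogonal decomposition of the `i`-th coordinate vector, both summands are supported at
`i`, hence determined by their values there. These values have product zero in a field, so one of
the summands vanishes. -/
theorem isPrimitiveIdempotent_pi_single {ι k : Type*} [DecidableEq ι] [Field k] (i : ι) :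
    IsPrimitiveIdempotent (Pi.single i 1 : ι → k) := by
  refine ⟨by simp, ?_, fun f g hf hg hfg _ h => ?_⟩
  · rw [IsIdempotentElem, ← Pi.single_mul, one_mul]
  -- Multiplying `f + g` by either summand returns that summand, by idempotency and orthogonality.
  -- This forces the support of each into `{i}`.
  · have hf' : f * Pi.single i 1 = f := by rw [h, mul_add, hf.eq, hfg, add_zero]
    have hg' : g * Pi.single i 1 = g := by rw [h, mul_add, hg.eq, mul_comm g f, hfg, zero_add]
    have hi : f i = 0 ∨ g i = 0 := mul_eq_zero.mp (congrFun hfg i)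
    refine hi.imp (fun hi => ?_) (fun hi => ?_)
    · rw [← hf', ← Pi.single_mul_right, hi, zero_mul, Pi.single_zero]
    · rw [← hg', ← Pi.single_mul_right, hi, zero_mul, Pi.single_zero]

/-- A subset of a split semisimple commutative algebra that is closed under left
multiplication and has a non-zero element contains a primitive idempotent. -/
theorem exists_isPrimitiveIdempotent_mem {k S : Type*} [Field k] [Ring S] [Algebra k S] {n : ℕ}
    (φ : S ≃ₐ[k] (Fin n → k)) {I : Set S} (hI : ∀ a x : S, x ∈ I → a * x ∈ I) {x : S}
    (hx : x ∈ I) (h0 : x ≠ 0) : ∃ e ∈ I, IsPrimitiveIdempotent e := by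
  have h0' : φ x ≠ 0 := by simpa using h0
  -- The choice of `i` also disposes of `n = 0`: a non-zero vector has a non-zero coordinate.
  obtain ⟨i, hi⟩ := Function.ne_iff.mp h0'
  refine ⟨φ.symm (Pi.single i 1), ?_,
    (isPrimitiveIdempotent_pi_single i).map_ringEquiv φ.symm.toRingEquiv⟩
  -- The multiplier does two jobs: it kills every coordinate of `φ x` other than the `i`-th, and it
  -- rescales that one to `1`.
  have h : φ.symm (Pi.single i 1) = φ.symm (Pi.single i (φ x i)⁻¹) * x := by
    apply φ.injective
    rw [map_mul, φ.apply_symm_apply, φ.apply_symm_apply]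
    ext j
    rcases eq_or_ne j i with rfl | hj
    · simpa using (inv_mul_cancel₀ hi).symm
    · simp [hj]
  exact h ▸ hI _ x hx

/-! ### Ideals of Green biset functors evaluated at a group. -/

variable {R : Type v} [CommRing R] {D : FiniteGrp.{u} → Prop} [IsBisetClass D]

/-- The evaluation of an ideal of `A` at `G` is a left ideal of `A(G)`. -/
theorem Ideal.mul_mem {A : GreenBisetFunctor.{u, v, w} R D} (F : A.Ideal) {G : BisetCat R D}
    (a x : A.ev G) (hx : x ∈ F.obj G) : a * x ∈ F.obj G :=
  -- By definition `a * x` is the image of `a × x` under `diagMor`, which is the morphism filled in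
  -- for the underscore.
  F.map_mem _ (F.times_mem_left a hx)

end GreenBisetFunctor

/-! ### Orders of proper subgroups and proper quotients, and the conclusion. -/

theorem Subgroup.natCard_lt_of_lt_top {G : Type*} [Group G] [Finite G] {K : Subgroup G}
    (hK : K < ⊤) : Nat.card K < Nat.card G :=
  lt_of_le_of_ne K.card_le_card_group fun h => hK.ne (K.eq_top_of_card_eq h)

/-- By Lagrange `|G| = |G/N| · |N|`, and `|N| > 1` as soon as `N` is non-trivial. -/
theorem Subgroup.natCard_quotient_lt_of_ne_bot {G : Type*} [Group G] [Finite G] {N : Subgroup G}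
    (hN : N ≠ ⊥) : Nat.card (G ⧸ N) < Nat.card G := by
  rw [N.card_eq_card_quotient_mul_card_subgroup]
  exact lt_mul_of_one_lt_right Nat.card_pos (N.one_lt_card_iff_ne_bot.mpr hN)

theorem mainTheorem4 {𝕂 : Type v} [Field 𝕂] [CharZero 𝕂] {D : FiniteGrp.{u} → Prop}
    [IsBisetClass D] (A : GreenBisetFunctor.{u, v, w} 𝕂 D)
    (hA : A.IsSplitSemisimpleCommutative) (F : A.Ideal) (H : BisetCat 𝕂 D)
    (hH : F.IsMinimalGroup H) : A.IsMCGroup H := by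
  obtain ⟨hne, hmin⟩ := hH
  obtain ⟨n, ⟨φ⟩⟩ := hA H
  obtain ⟨x, hx, h0⟩ := (Submodule.ne_bot_iff _).mp hne
  obtain ⟨e, heF, he⟩ :=
    GreenBisetFunctor.exists_isPrimitiveIdempotent_mem φ (I := F.obj H) F.mul_mem hx h0
  -- Only the order of the target matters, not the type of morphism, so restrictions and deflations
  -- are covered by a single statement.
  have hzero : ∀ (T : BisetCat 𝕂 D) (f : H ⟶ T), Nat.card T.grp < Nat.card H.grp →
      A.map f e = 0 := fun T f hT => by
    have h := F.map_mem f heF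
    rwa [hmin T hT, Submodule.mem_bot] at h
  -- The same `e` must serve in both `ERes` and `EDef`. The targets are `H.sub K` and `H.quot N`,
  -- whose underlying groups are `K` and `H/N` by definition, so the two order estimates apply
  -- directly.
  exact ⟨e, ⟨he, fun K hK => hzero _ _ (Subgroup.natCard_lt_of_lt_top hK)⟩,
    he, fun N _ hN => hzero _ _ (Subgroup.natCard_quotient_lt_of_ne_bot hN)⟩
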